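/- Let $\lambda$ be the real root of $x^3-x^2+1$ and let $z,\bar z$ be its other two complex roots. Put $E=\mathbb{Q}(\lambda,z)$ and $F=\mathbb{Q}(\sqrt{-23})$, as subfields of $\mathbb{C}$. Then $F\subset E$, and there is an automorphism $\sigma$ of $E$ over $F$, with $\sigma^3=1$, such that $$\sigma(\lambda)=z,\qquad \sigma(z)=\bar z,\qquad \sigma(\bar z)=\lambda .$$ Let $B=E\oplus vE\oplus v^2E$ be the cyclic algebra with $v^3=3$ and $e\cdot v=v\cdot\sigma(e)$ for $e\in E$. Then $B$ is a division ring with center $F$ and $[B:F]=9$, and there is a positive anti-involution of the second kind on $B$ over $\mathbb{Q}$; that is, there is a $\mathbb{Q}$-linear map $\phi:B\to B$ such that 1. $\phi(1)=1$, and $\phi(\phi(x))=x$, $\phi(xy)=\phi(y)\phi(x)$ for all $x,y\in B$; 2. $\mathrm{Tr}_{B/\mathbb{Q}}(\phi(x)x)>0$ for all $x\in B\setminus\{0\}$, where $\mathrm{Tr}_{B/\mathbb{Q}}(y)$ is the trace of the $\mathbb{Q}$-linear map $x\mapsto yx$ on $B$; 3. $\phi$ is not the identity on the center of $B$. -/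

import Mathlib

section CyclicAlgebra

variable {F E : Type*} [Field F] [Field E] [Algebra F E]

/-- The cyclic algebra of degree three `E ⊕ v E ⊕ v² E`, with `v ^ 3 = u` and
`e * v = v * σ e` for `e` in `E`, where `σ` is an `F`-automorphism of `E` with `σ ^ 3 = 1` and
`u` is in `F`. The triple `⟨a, b, c⟩` stands for `a + v b + v² c`. -/
@[ext]
structure CubicCyclicAlgebra (σ : E ≃ₐ[F] E) (hσ : σ ^ 3 = 1) (u : F) where
  /-- the coefficient of `1` -/
  c0 : E
  /-- the coefficient of `v` -/
  c1 : E
  /-- the coefficient of `v²` -/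
  c2 : E

namespace CubicCyclicAlgebra

variable {σ : E ≃ₐ[F] E} {hσ : σ ^ 3 = 1} {u : F}

instance : Zero (CubicCyclicAlgebra σ hσ u) := ⟨⟨0, 0, 0⟩⟩
instance : One (CubicCyclicAlgebra σ hσ u) := ⟨⟨1, 0, 0⟩⟩
instance : Add (CubicCyclicAlgebra σ hσ u) :=
  ⟨fun x y => ⟨x.c0 + y.c0, x.c1 + y.c1, x.c2 + y.c2⟩⟩
instance : Neg (CubicCyclicAlgebra σ hσ u) := ⟨fun x => ⟨-x.c0, -x.c1, -x.c2⟩⟩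
instance : Sub (CubicCyclicAlgebra σ hσ u) :=
  ⟨fun x y => ⟨x.c0 - y.c0, x.c1 - y.c1, x.c2 - y.c2⟩⟩

/-- The product determined by
`(v ^ i * a) * (v ^ j * b) = v ^ (i + j) * (σ ^ j) a * b` and `v ^ 3 = u`. -/
instance : Mul (CubicCyclicAlgebra σ hσ u) :=
  ⟨fun x y =>
    ⟨x.c0 * y.c0 + algebraMap F E u * (σ x.c2 * y.c1 + σ (σ x.c1) * y.c2),
      x.c1 * y.c0 + σ x.c0 * y.c1 + algebraMap F E u * (σ (σ x.c2) * y.c2),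
      x.c2 * y.c0 + σ x.c1 * y.c1 + σ (σ x.c0) * y.c2⟩⟩

/-- Scalars act on each coefficient. -/
instance {R : Type*} [SMul R E] : SMul R (CubicCyclicAlgebra σ hσ u) :=
  ⟨fun r x => ⟨r • x.c0, r • x.c1, r • x.c2⟩⟩

@[simp] theorem zero_c0 : (0 : CubicCyclicAlgebra σ hσ u).c0 = 0 := rfl
@[simp] theorem zero_c1 : (0 : CubicCyclicAlgebra σ hσ u).c1 = 0 := rfl
@[simp] theorem zero_c2 : (0 : CubicCyclicAlgebra σ hσ u).c2 = 0 := rfl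
@[simp] theorem one_c0 : (1 : CubicCyclicAlgebra σ hσ u).c0 = 1 := rfl
@[simp] theorem one_c1 : (1 : CubicCyclicAlgebra σ hσ u).c1 = 0 := rfl
@[simp] theorem one_c2 : (1 : CubicCyclicAlgebra σ hσ u).c2 = 0 := rfl

section
variable (x y : CubicCyclicAlgebra σ hσ u)
@[simp] theorem add_c0 : (x + y).c0 = x.c0 + y.c0 := rfl
@[simp] theorem add_c1 : (x + y).c1 = x.c1 + y.c1 := rfl
@[simp] theorem add_c2 : (x + y).c2 = x.c2 + y.c2 := rfl
@[simp] theorem neg_c0 : (-x).c0 = -x.c0 := rfl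
@[simp] theorem neg_c1 : (-x).c1 = -x.c1 := rfl
@[simp] theorem neg_c2 : (-x).c2 = -x.c2 := rfl
@[simp] theorem sub_c0 : (x - y).c0 = x.c0 - y.c0 := rfl
@[simp] theorem sub_c1 : (x - y).c1 = x.c1 - y.c1 := rfl
@[simp] theorem sub_c2 : (x - y).c2 = x.c2 - y.c2 := rfl
@[simp] theorem mul_c0 : (x * y).c0 =
    x.c0 * y.c0 + algebraMap F E u * (σ x.c2 * y.c1 + σ (σ x.c1) * y.c2) := rfl
@[simp] theorem mul_c1 : (x * y).c1 =
    x.c1 * y.c0 + σ x.c0 * y.c1 + algebraMap F E u * (σ (σ x.c2) * y.c2) := rfl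
@[simp] theorem mul_c2 : (x * y).c2 =
    x.c2 * y.c0 + σ x.c1 * y.c1 + σ (σ x.c0) * y.c2 := rfl
@[simp] theorem smul_c0 {R : Type*} [SMul R E] (r : R) : (r • x).c0 = r • x.c0 := rfl
@[simp] theorem smul_c1 {R : Type*} [SMul R E] (r : R) : (r • x).c1 = r • x.c1 := rfl
@[simp] theorem smul_c2 {R : Type*} [SMul R E] (r : R) : (r • x).c2 = r • x.c2 := rfl
end

theorem apply_three {σ : E ≃ₐ[F] E} (hσ : σ ^ 3 = 1) (e : E) : σ (σ (σ e)) = e := by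
  have h := congrArg (fun τ : E ≃ₐ[F] E => τ e) hσ
  simpa [pow_succ] using h

instance : AddCommGroup (CubicCyclicAlgebra σ hσ u) where
  add_assoc x y z := by ext <;> simp [add_assoc]
  zero_add x := by ext <;> simp
  add_zero x := by ext <;> simp
  add_comm x y := by ext <;> simp [add_comm]
  neg_add_cancel x := by ext <;> simp
  sub_eq_add_neg x y := by ext <;> simp [sub_eq_add_neg]
  nsmul n x := n • x
  nsmul_zero x := by ext <;> simp
  nsmul_succ n x := by ext <;> simp [add_mul]
  zsmul n x := n • x
  zsmul_zero' x := by ext <;> simp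
  zsmul_succ' n x := by ext <;> simp [add_mul]
  zsmul_neg' n x := by ext <;> simp [Int.negSucc_eq] <;> ring

instance : Ring (CubicCyclicAlgebra σ hσ u) where
  zero_mul x := by ext <;> simp
  mul_zero x := by ext <;> simp
  one_mul x := by ext <;> simp
  mul_one x := by ext <;> simp
  left_distrib x y z := by ext <;> simp <;> ring
  right_distrib x y z := by ext <;> simp <;> ring
  mul_assoc x y z := by ext <;> simp [apply_three hσ] <;> ring
  neg_add_cancel := neg_add_cancel
  sub_eq_add_neg := sub_eq_add_neg
  zsmul n x := n • x
  zsmul_zero' := SubNegMonoid.zsmul_zero'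
  zsmul_succ' := SubNegMonoid.zsmul_succ'
  zsmul_neg' := SubNegMonoid.zsmul_neg'

/-- The cyclic algebra is an algebra over `F`, and over every commutative ring `R` over which
`F` is an algebra, through `R → F → E ⊆ E ⊕ v E ⊕ v² E`. -/
instance {R : Type*} [CommSemiring R] [Algebra R F] [Algebra R E] [IsScalarTower R F E] :
    Algebra R (CubicCyclicAlgebra σ hσ u) where
  algebraMap :=
    { toFun := fun r => ⟨algebraMap R E r, 0, 0⟩
      map_zero' := by ext <;> simp
      map_one' := by ext <;> simp
      map_add' := fun r s => by ext <;> simp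
      map_mul' := fun r s => by ext <;> simp }
  commutes' r x := by
    have h : σ (algebraMap R E r) = algebraMap R E r := by
      rw [IsScalarTower.algebraMap_apply R F E, AlgEquiv.commutes]
    ext <;> simp [h, mul_comm]
  smul_def' r x := by
    have h : σ (algebraMap R E r) = algebraMap R E r := by
      rw [IsScalarTower.algebraMap_apply R F E, AlgEquiv.commutes]
    ext <;> simp [h, Algebra.smul_def]

end CubicCyclicAlgebra

end CyclicAlgebra

section Involution

variable {B : Type*} [Ring B] [Algebra ℚ B]

/-- A `ℚ`-linear anti-involution of a `ℚ`-algebra. -/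
structure IsAntiInvolution (φ : B →ₗ[ℚ] B) : Prop where
  map_one : φ 1 = 1
  involutive : ∀ x, φ (φ x) = x
  map_mul : ∀ x y, φ (x * y) = φ y * φ x

/-- A positive anti-involution over `ℚ`; the trace over `ℚ` of an element `y` of `B` is that of the
`ℚ`-linear map `x ↦ y * x` on `B`. -/
structure IsPositiveAntiInvolution (φ : B →ₗ[ℚ] B) : Prop extends IsAntiInvolution φ where
  trace_pos : ∀ x, x ≠ 0 → 0 < LinearMap.trace ℚ B (LinearMap.mulLeft ℚ (φ x * x))

/-- `φ` is of the second kind: it is not the identity on the center of `B`. -/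
def IsOfSecondKind (φ : B →ₗ[ℚ] B) : Prop :=
  ∃ x ∈ Subalgebra.center ℚ B, φ x ≠ x

end Involution

/-- The subfield `ℚ(√-23)` of `ℂ`. -/
noncomputable def fieldF : IntermediateField ℚ ℂ :=
  IntermediateField.adjoin ℚ {((Real.sqrt 23 : ℝ) : ℂ) * Complex.I}

/-- The subfield `ℚ(lam, z)` of `ℂ`. -/
noncomputable def fieldE (lam : ℝ) (z : ℂ) : IntermediateField ℚ ℂ :=
  IntermediateField.adjoin ℚ {(lam : ℂ), z}

/-! Division property. Since $-23\equiv 1 \pmod 3$, $F$ embeds in $\mathbb{Q}_3$. The cubic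
$x^3-x^2+1$ stays irreducible modulo 3, so the norm form of $E/F$ is anisotropic over $\mathbb{Q}_3$
and its values have 3-adic valuation divisible by 3 (`norm_cubicNormForm`). The reduced norm of
$a+vb+v^2c$ is $N(a)+3N(b)+9N(c)-3\,\mathrm{Tr}(a\,\sigma b\,\sigma^2 c)$. The valuations of its
first three terms differ modulo 3, and the trace term is too small to cancel the dominant one, so
the sum vanishes only at $0$ (`IsCubicGenerator.isUnit_of_ne_zero`).

Involution. Complex conjugation $\tau$ on $E$ satisfies $\tau\sigma=\sigma^{-1}\tau$, so there is an
anti-involution $\varphi_0$ that is $\tau$ on $E$ and fixes $v$. Under the representation of $B$ by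
$3\times 3$ complex matrices it is the adjoint for a Hermitian form $H$ which is indefinite. It is
therefore replaced by $\varphi(x)=t^{-1}\varphi_0(x)t$ with $\varphi_0(t)=t$, which is the adjoint
for $S=HM(t)$, where $M(t)$ is the matrix of $t$. For $t=p+v\sigma^2(p)+v^2\sigma(p)$ and
$p=(1-\lambda)^2$ the form $S$ is positive definite, and the trace of $\varphi(x)x$ becomes a
squared Frobenius norm (`Matrix.PosDef.trace_mul_pos_of_adjoint`). As $\tau$ negates $\sqrt{-23}$,
$\varphi$ is of the second kind. -/

/-! ### The cubic norm form over the 3-adic numbers -/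

/-- The norm form of `ℤ[X] / (X³ - X² + 1)` in the basis `1, X, X²`. -/
def cubicNormForm {R : Type*} [CommRing R] (a b c : R) : R :=
  a ^ 3 + a ^ 2 * b + a ^ 2 * c + 3 * a * b * c + 2 * a * c ^ 2 - b ^ 3 - b ^ 2 * c + c ^ 3

theorem map_cubicNormForm {R S : Type*} [CommRing R] [CommRing S] (f : R →+* S) (a b c : R) :
    f (cubicNormForm a b c) = cubicNormForm (f a) (f b) (f c) := by
  simp [cubicNormForm, map_ofNat]

/-- The form is the norm from the field with 27 elements, because the cubic has no root modulo 3;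
finitely many cases suffice. -/
theorem cubicNormForm_zmod_three :
    ∀ a b c : ZMod 3, cubicNormForm a b c = 0 → a = 0 ∧ b = 0 ∧ c = 0 := by
  unfold cubicNormForm
  decide

theorem PadicInt.norm_eq_one_of_toZMod_ne_zero {p : ℕ} [Fact p.Prime] {x : ℤ_[p]}
    (h : PadicInt.toZMod x ≠ 0) : ‖x‖ = 1 := by
  by_contra h1
  apply h
  rw [← RingHom.mem_ker, PadicInt.ker_toZMod, IsLocalRing.mem_maximalIdeal]
  exact PadicInt.mem_nonunits.2 (lt_of_le_of_ne (PadicInt.norm_le_one x) h1)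

theorem PadicInt.toZMod_ne_zero_of_norm_eq_one {p : ℕ} [Fact p.Prime] {x : ℤ_[p]}
    (h : ‖x‖ = 1) : PadicInt.toZMod x ≠ 0 := by
  intro h0
  rw [← RingHom.mem_ker, PadicInt.ker_toZMod, IsLocalRing.mem_maximalIdeal] at h0
  exact absurd h (ne_of_lt (PadicInt.mem_nonunits.1 h0))

theorem norm_cubicNormForm_padicInt {a b c : ℤ_[3]} (h : ‖a‖ = 1 ∨ ‖b‖ = 1 ∨ ‖c‖ = 1) :
    ‖cubicNormForm a b c‖ = 1 := by
  apply PadicInt.norm_eq_one_of_toZMod_ne_zero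
  rw [map_cubicNormForm]
  intro h0
  obtain ⟨ha, hb, hc⟩ := cubicNormForm_zmod_three _ _ _ h0
  rcases h with h | h | h
  · exact PadicInt.toZMod_ne_zero_of_norm_eq_one h ha
  · exact PadicInt.toZMod_ne_zero_of_norm_eq_one h hb
  · exact PadicInt.toZMod_ne_zero_of_norm_eq_one h hc

/-- Dividing by `k` makes the coordinates 3-adic integers, one of them a unit, and the form is
homogeneous of degree 3. -/
theorem norm_cubicNormForm_of_bound {a b c k : ℚ_[3]} (ha : ‖a‖ ≤ ‖k‖) (hb : ‖b‖ ≤ ‖k‖)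
    (hc : ‖c‖ ≤ ‖k‖) (h : ‖a‖ = ‖k‖ ∨ ‖b‖ = ‖k‖ ∨ ‖c‖ = ‖k‖) :
    ‖cubicNormForm a b c‖ = ‖k‖ ^ 3 := by
  rcases eq_or_ne k 0 with rfl | hk
  · simp only [norm_zero, norm_le_zero_iff] at ha hb hc
    simp [ha, hb, hc, cubicNormForm]
  have hk' : 0 < ‖k‖ := norm_pos_iff.2 hk
  have key : ∀ x : ℚ_[3], ‖x‖ ≤ ‖k‖ → ∃ y : ℤ_[3], x = k * y := fun x hx => by
    have h1 : ‖x / k‖ ≤ 1 := by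
      rw [norm_div]
      exact (div_le_one hk').2 hx
    exact ⟨⟨x / k, h1⟩, (mul_div_cancel₀ x hk).symm⟩
  obtain ⟨a, rfl⟩ := key a ha
  obtain ⟨b, rfl⟩ := key b hb
  obtain ⟨c, rfl⟩ := key c hc
  simp only [norm_mul, mul_eq_left₀ hk'.ne', ← PadicInt.norm_def] at h
  have h1 := norm_cubicNormForm_padicInt h
  have h2 := map_cubicNormForm (PadicInt.Coe.ringHom (p := 3)) a b c
  have h3 : cubicNormForm (k * a) (k * b) (k * c) =
      k ^ 3 * cubicNormForm (a : ℚ_[3]) (b : ℚ_[3]) (c : ℚ_[3]) := by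
    simp only [cubicNormForm]
    ring
  rw [PadicInt.norm_def] at h1
  change ((cubicNormForm a b c : ℤ_[3]) : ℚ_[3]) = cubicNormForm (a : ℚ_[3]) b c at h2
  rw [h3, norm_mul, norm_pow, ← h2, h1, mul_one]

/-- The norm form takes the cube of the maximum norm as its norm, as `X³ - X² + 1` is irreducible
modulo three. -/
theorem norm_cubicNormForm (a b c : ℚ_[3]) :
    ‖cubicNormForm a b c‖ = max ‖a‖ (max ‖b‖ ‖c‖) ^ 3 := by
  rcases le_total ‖b‖ ‖c‖ with h | h <;> rcases le_total ‖a‖ (max ‖b‖ ‖c‖) with h' | h' <;>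
    simp only [h, max_eq_left, max_eq_right] at h' ⊢ <;> simp only [h', max_eq_left, max_eq_right]
  · exact norm_cubicNormForm_of_bound h' h le_rfl (by simp)
  · exact norm_cubicNormForm_of_bound le_rfl (h.trans h') h' (by simp)
  · exact norm_cubicNormForm_of_bound h' le_rfl h (by simp)
  · exact norm_cubicNormForm_of_bound le_rfl h' (h.trans h') (by simp)

/-- Nonzero norms are integral powers of 3, so a strict inequality gains a factor 3. -/
theorem Padic.three_mul_norm_le {x y : ℚ_[3]} (h : ‖x‖ < ‖y‖) : 3 * ‖x‖ ≤ ‖y‖ := by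
  have hy : y ≠ 0 := by
    rintro rfl
    exact absurd h (by simp)
  have hy' : 0 < ‖y‖ := norm_pos_iff.2 hy
  have h1 : ‖x / y‖ < (3 : ℕ) ^ ((-1 : ℤ) + 1) := by
    rw [norm_div]
    simpa using (div_lt_one hy').2 h
  have h2 := (Padic.norm_le_pow_iff_norm_lt_pow_add_one (x / y) (-1)).2 h1
  rw [norm_div, div_le_iff₀ hy'] at h2
  norm_num at h2
  linarith

theorem Padic.norm_three : ‖(3 : ℚ_[3])‖ = 3⁻¹ := by
  simpa using Padic.norm_p (p := 3)

theorem Padic.exists_sq_eq_neg_twentythree : ∃ r : ℚ_[3], r ^ 2 = -23 := by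
  have h24 : ‖(24 : ℤ_[3])‖ < 1 := by
    have : (24 : ℤ_[3]) = ((24 : ℤ) : ℤ_[3]) := by norm_num
    rw [this, PadicInt.norm_intCast_lt_one_iff]
    norm_num
  have h2 : ‖(2 : ℤ_[3])‖ = 1 := by
    have : (2 : ℤ_[3]) = ((2 : ℤ) : ℤ_[3]) := by norm_num
    refine le_antisymm (PadicInt.norm_le_one _) (not_lt.1 ?_)
    rw [this, PadicInt.norm_intCast_lt_one_iff]
    norm_num
  -- At the approximate root 1 the value is 24, divisible by 3, and the derivative is 2, a unit.
  obtain ⟨r, hr, -⟩ := hensels_lemma (p := 3) (F := (Polynomial.X ^ 2 + 23 : Polynomial ℤ_[3]))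
    (a := 1) (by
      simp
      norm_num [h2, h24])
  refine ⟨r, ?_⟩
  have h3 : r ^ 2 + 23 = 0 := by simpa using hr
  have h4 : ((r ^ 2 + 23 : ℤ_[3]) : ℚ_[3]) = 0 := by rw [h3]; simp
  push_cast at h4
  exact eq_neg_of_add_eq_zero_left h4

/-! ### Reduced norm, dimension and center of the cyclic algebra -/

namespace CubicCyclicAlgebra

variable {F E : Type*} [Field F] [Field E] [Algebra F E]
variable {σ : E ≃ₐ[F] E} {hσ : σ ^ 3 = 1} {u : F}

/-- The adjugate for left and right multiplication. -/
def adjugate (x : CubicCyclicAlgebra σ hσ u) : CubicCyclicAlgebra σ hσ u :=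
  ⟨σ x.c0 * σ (σ x.c0) - algebraMap F E u * (σ x.c1 * σ (σ x.c2)),
    algebraMap F E u * (x.c2 * σ (σ x.c2)) - x.c1 * σ (σ x.c0),
    x.c1 * σ x.c1 - x.c2 * σ x.c0⟩

/-- The reduced norm, as an element of `E`. -/
def reducedNorm (x : CubicCyclicAlgebra σ hσ u) : E :=
  x.c0 * σ x.c0 * σ (σ x.c0) + algebraMap F E u * (x.c1 * σ x.c1 * σ (σ x.c1)) +
    algebraMap F E u ^ 2 * (x.c2 * σ x.c2 * σ (σ x.c2)) -
    algebraMap F E u * (x.c0 * σ x.c1 * σ (σ x.c2) + σ (x.c0 * σ x.c1 * σ (σ x.c2)) +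
      σ (σ (x.c0 * σ x.c1 * σ (σ x.c2))))

theorem mul_adjugate (x : CubicCyclicAlgebra σ hσ u) : x * x.adjugate = ⟨x.reducedNorm, 0, 0⟩ := by
  ext <;> simp [adjugate, reducedNorm, apply_three hσ] <;> ring

theorem adjugate_mul (x : CubicCyclicAlgebra σ hσ u) : x.adjugate * x = ⟨x.reducedNorm, 0, 0⟩ := by
  ext <;> simp [adjugate, reducedNorm, apply_three hσ] <;> ring

theorem isUnit_of_reducedNorm_ne_zero {x : CubicCyclicAlgebra σ hσ u} (hx : x.reducedNorm ≠ 0) :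
    IsUnit x := by
  have h1 : x * (x.adjugate * ⟨x.reducedNorm⁻¹, 0, 0⟩) = 1 := by
    rw [← mul_assoc, mul_adjugate]
    ext <;> simp [hx]
  have h2 : ((⟨x.reducedNorm⁻¹, 0, 0⟩ : CubicCyclicAlgebra σ hσ u) * x.adjugate) * x = 1 := by
    rw [mul_assoc, adjugate_mul]
    ext <;> simp [hx]
  rw [← left_inv_eq_right_inv h2 h1] at h1
  exact ⟨⟨x, _, h1, h2⟩, rfl⟩

/-- The coefficients, as a linear equivalence. -/
def coeffEquiv (R : Type*) [CommSemiring R] [Algebra R F] [Algebra R E] [IsScalarTower R F E] :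
    CubicCyclicAlgebra σ hσ u ≃ₗ[R] E × E × E where
  toFun x := (x.c0, x.c1, x.c2)
  invFun p := ⟨p.1, p.2.1, p.2.2⟩
  map_add' _ _ := rfl
  map_smul' _ _ := rfl
  left_inv _ := rfl
  right_inv _ := rfl

theorem finrank_eq [FiniteDimensional F E] :
    Module.finrank F (CubicCyclicAlgebra σ hσ u) = 3 * Module.finrank F E := by
  rw [(coeffEquiv F).finrank_eq, Module.finrank_prod, Module.finrank_prod]
  ring

/-- Commuting with `l` kills the coefficients of $v$ and $v^2$; commuting with $v$ makes the
remaining one fixed by `σ`. -/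
theorem isCentral_of_fixed (l : E) (h1 : σ l ≠ l) (h2 : σ (σ l) ≠ l)
    (hfix : ∀ e : E, σ e = e → ∃ a : F, algebraMap F E a = e) :
    Algebra.IsCentral F (CubicCyclicAlgebra σ hσ u) := by
  constructor
  intro x hx
  rw [Subalgebra.mem_center_iff] at hx
  have hl := hx ⟨l, 0, 0⟩
  have hv := hx ⟨0, 1, 0⟩
  have hl1 := congrArg c1 hl
  have hl2 := congrArg c2 hl
  have hv1 := congrArg c1 hv
  simp at hl1 hl2 hv1
  have e1 : x.c1 = 0 := by
    by_contra h
    exact h1 (mul_right_cancel₀ h (hl1.trans (mul_comm _ _)))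
  have e2 : x.c2 = 0 := by
    by_contra h
    exact h2 (mul_right_cancel₀ h (hl2.trans (mul_comm _ _)))
  obtain ⟨a, ha⟩ := hfix x.c0 hv1.symm
  rw [Algebra.mem_bot]
  refine ⟨a, ?_⟩
  ext
  · exact ha
  · exact e1.symm
  · exact e2.symm

end CubicCyclicAlgebra

/-! ### Norm and trace of the cubic extension, and the division property -/

section CubicBasis

variable {F E : Type*} [Field F] [Field E] [Algebra F E]

/-- The extension `E` of `F` is spanned by `1, l, l²`, where `l` is a root of `X³ - X² + 1` whose
conjugates are permuted cyclically by `σ`. -/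
structure IsCubicGenerator (σ : E ≃ₐ[F] E) (l : E) : Prop where
  pow_three : σ ^ 3 = 1
  esymm_one : l + σ l + σ (σ l) = 1
  esymm_two : l * σ l + l * σ (σ l) + σ l * σ (σ l) = 0
  esymm_three : l * σ l * σ (σ l) = -1
  span : ∀ e : E, ∃ a b c : F, e = algebraMap F E a + algebraMap F E b * l + algebraMap F E c * l ^ 2

namespace IsCubicGenerator

variable {σ : E ≃ₐ[F] E} {l : E} (h : IsCubicGenerator σ l)
include h

theorem norm_eq (a b c : F) {e : E}
    (he : e = algebraMap F E a + algebraMap F E b * l + algebraMap F E c * l ^ 2) :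
    e * σ e * σ (σ e) = algebraMap F E (cubicNormForm a b c) := by
  have key : ∀ a b c l m n : E, (a + b * l + c * l ^ 2) * (a + b * m + c * m ^ 2) *
      (a + b * n + c * n ^ 2) = a ^ 3 + a ^ 2 * b * (l + m + n) +
      a ^ 2 * c * ((l + m + n) ^ 2 - 2 * (l * m + l * n + m * n)) +
      a * b ^ 2 * (l * m + l * n + m * n) +
      a * b * c * ((l + m + n) * (l * m + l * n + m * n) - 3 * (l * m * n)) +
      a * c ^ 2 * ((l * m + l * n + m * n) ^ 2 - 2 * (l + m + n) * (l * m * n)) +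
      b ^ 3 * (l * m * n) + b ^ 2 * c * ((l + m + n) * (l * m * n)) +
      b * c ^ 2 * ((l * m + l * n + m * n) * (l * m * n)) + c ^ 3 * (l * m * n) ^ 2 := by
    intros
    ring
  rw [map_cubicNormForm, he]
  simp only [map_add, map_mul, map_pow, AlgEquiv.commutes]
  rw [key, h.esymm_one, h.esymm_two, h.esymm_three, cubicNormForm]
  ring

theorem trace_eq (a b c : F) {e : E}
    (he : e = algebraMap F E a + algebraMap F E b * l + algebraMap F E c * l ^ 2) :
    e + σ e + σ (σ e) = algebraMap F E (3 * a + b + c) := by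
  have key : ∀ a b c l m n : E, (a + b * l + c * l ^ 2) + (a + b * m + c * m ^ 2) +
      (a + b * n + c * n ^ 2) = 3 * a + b * (l + m + n) +
      c * ((l + m + n) ^ 2 - 2 * (l * m + l * n + m * n)) := by
    intros
    ring
  rw [he]
  simp only [map_add, map_mul, map_pow, AlgEquiv.commutes, map_ofNat]
  rw [key, h.esymm_one, h.esymm_two]
  ring

theorem exists_trace (e : E) : ∃ s : F, e + σ e + σ (σ e) = algebraMap F E s := by
  obtain ⟨a, b, c, he⟩ := h.span e
  exact ⟨_, h.trace_eq a b c he⟩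

/-- The trace of a fixed element is three times that element, and traces lie in `F`. -/
theorem exists_of_fixed [CharZero F] (e : E) (he : σ e = e) : ∃ a : F, algebraMap F E a = e := by
  obtain ⟨s, hs⟩ := h.exists_trace e
  rw [he, he] at hs
  have : CharZero E := charZero_of_injective_algebraMap (algebraMap F E).injective
  refine ⟨s / 3, ?_⟩
  rw [map_div₀, ← hs, map_ofNat]
  ring

/-- The `3`-adic size on `E`: the maximum norm of the coordinates. -/
theorem exists_size (ι : F →+* ℚ_[3]) (e : E) :
    ∃ k : ℚ_[3], (k = 0 → e = 0) ∧
      (∃ s : F, e * σ e * σ (σ e) = algebraMap F E s ∧ ‖ι s‖ = ‖k‖ ^ 3) ∧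
      ∃ t : F, e + σ e + σ (σ e) = algebraMap F E t ∧ ‖ι t‖ ≤ ‖k‖ := by
  obtain ⟨a, b, c, he⟩ := h.span e
  -- The size is carried by a 3-adic number, not a real one, so that it remains in the value group
  -- of $\mathbb{Q}_3$.
  obtain ⟨k, hk⟩ : ∃ k : ℚ_[3], ‖k‖ = max ‖ι a‖ (max ‖ι b‖ ‖ι c‖) := by
    rcases max_choice ‖ι b‖ ‖ι c‖ with h1 | h1 <;>
      rcases max_choice ‖ι a‖ (max ‖ι b‖ ‖ι c‖) with h2 | h2 <;> rw [h2]
    · exact ⟨_, rfl⟩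
    · exact ⟨_, h1.symm⟩
    · exact ⟨_, rfl⟩
    · exact ⟨_, h1.symm⟩
  have ha : ‖ι a‖ ≤ ‖k‖ := hk ▸ le_max_left _ _
  have hb : ‖ι b‖ ≤ ‖k‖ := hk ▸ (le_max_left _ _).trans (le_max_right _ _)
  have hc : ‖ι c‖ ≤ ‖k‖ := hk ▸ (le_max_right _ _).trans (le_max_right _ _)
  refine ⟨k, ?_, ⟨_, h.norm_eq a b c he, ?_⟩, _, h.trace_eq a b c he, ?_⟩
  · rintro rfl
    simp only [norm_zero, norm_le_zero_iff, map_eq_zero] at ha hb hc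
    simp [he, ha, hb, hc]
  · rw [map_cubicNormForm, norm_cubicNormForm, hk]
  · simp only [map_add, map_mul, map_ofNat]
    refine (Padic.nonarchimedean _ _).trans (max_le ((Padic.nonarchimedean _ _).trans
      (max_le ?_ hb)) hc)
    rw [norm_mul, Padic.norm_three]
    linarith [norm_nonneg (ι a)]

/-- A vanishing combination has norm zero, and the norm form is anisotropic over $\mathbb{Q}_3$. -/
theorem linearIndependent (ι : F →+* ℚ_[3]) (a b c : F)
    (h0 : algebraMap F E a + algebraMap F E b * l + algebraMap F E c * l ^ 2 = 0) :
    a = 0 ∧ b = 0 ∧ c = 0 := by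
  have h1 := h.norm_eq a b c h0.symm
  rw [zero_mul, zero_mul, eq_comm, map_eq_zero] at h1
  have h2 := norm_cubicNormForm (ι a) (ι b) (ι c)
  rw [← map_cubicNormForm, h1, map_zero, norm_zero, eq_comm] at h2
  have h3 := eq_zero_of_pow_eq_zero h2
  have ha : ‖ι a‖ ≤ 0 := h3 ▸ le_max_left _ _
  have hb : ‖ι b‖ ≤ 0 := h3 ▸ (le_max_left _ _).trans (le_max_right _ _)
  have hc : ‖ι c‖ ≤ 0 := h3 ▸ (le_max_right _ _).trans (le_max_right _ _)
  simpa using And.intro ha (And.intro hb hc)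

theorem finrank_eq_three (ι : F →+* ℚ_[3]) : Module.finrank F E = 3 := by
  let f : (Fin 3 → F) →ₗ[F] E := Fintype.linearCombination F ![1, l, l ^ 2]
  have hf : ∀ v, f v = algebraMap F E (v 0) + algebraMap F E (v 1) * l +
      algebraMap F E (v 2) * l ^ 2 := fun v => by
    simp [f, Fintype.linearCombination_apply, Fin.sum_univ_three, Algebra.smul_def]
  have h1 : Function.Bijective f := by
    constructor
    · rw [injective_iff_map_eq_zero]
      intro v hv
      obtain ⟨h0, h1, h2⟩ := h.linearIndependent ι _ _ _ ((hf v).symm.trans hv)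
      funext i
      fin_cases i
      · exact h0
      · exact h1
      · exact h2
    · intro e
      obtain ⟨a, b, c, he⟩ := h.span e
      exact ⟨![a, b, c], by rw [hf, he]; simp⟩
  rw [← (LinearEquiv.ofBijective f h1).finrank_eq]
  simp

theorem isUnit_of_ne_zero (ι : F →+* ℚ_[3]) {hσ : σ ^ 3 = 1}
    {x : CubicCyclicAlgebra σ hσ (3 : F)} (hx : x ≠ 0) : IsUnit x := by
  apply CubicCyclicAlgebra.isUnit_of_reducedNorm_ne_zero
  obtain ⟨α, hα, ⟨sa, hsa, hsa'⟩, -⟩ := h.exists_size ι x.c0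
  obtain ⟨β, hβ, ⟨sb, hsb, hsb'⟩, -⟩ := h.exists_size ι x.c1
  obtain ⟨γ, hγ, ⟨sc, hsc, hsc'⟩, -⟩ := h.exists_size ι x.c2
  obtain ⟨κ, -, ⟨s, hs, hs'⟩, ⟨t, ht, ht'⟩⟩ := h.exists_size ι (x.c0 * σ x.c1 * σ (σ x.c2))
  have h1 : s = sa * sb * sc := by
    apply (algebraMap F E).injective
    rw [← hs, map_mul (algebraMap F E), map_mul (algebraMap F E), ← hsa, ← hsb, ← hsc]
    simp only [map_mul, CubicCyclicAlgebra.apply_three hσ]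
    ring
  -- The size is multiplicative because its cube is the 3-adic absolute value of the norm.
  have h2 : ‖κ‖ = ‖α‖ * ‖β‖ * ‖γ‖ := by
    rw [h1, map_mul, map_mul, norm_mul, norm_mul, hsa', hsb', hsc', ← mul_pow, ← mul_pow] at hs'
    exact ((pow_left_inj₀ (by positivity) (by positivity) three_ne_zero).1 hs').symm
  rw [h2] at ht'
  intro h0
  have h3 : sa + 3 * sb + 9 * sc - 3 * t = 0 := by
    apply (algebraMap F E).injective
    rw [map_zero, ← h0, CubicCyclicAlgebra.reducedNorm, hsa, hsb, hsc, ht]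
    simp only [map_sub, map_add, map_mul, map_ofNat]
    ring
  have h4 : ι sa + 3 * ι sb + 9 * ι sc - 3 * ι t = 0 := by
    rw [← map_zero ι, ← h3]
    simp only [map_sub, map_add, map_mul, map_ofNat]
  have n3 := Padic.norm_three
  have n9 : ‖(9 : ℚ_[3])‖ = 9⁻¹ := by
    rw [show (9 : ℚ_[3]) = 3 * 3 by norm_num, norm_mul, n3]
    norm_num
  have m1 : ‖3 * ι sb‖ = ‖β‖ ^ 3 / 3 := by rw [norm_mul, n3, hsb']; ring
  have m2 : ‖9 * ι sc‖ = ‖γ‖ ^ 3 / 9 := by rw [norm_mul, n9, hsc']; ring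
  have m3 : ‖3 * ι t‖ ≤ ‖α‖ * ‖β‖ * ‖γ‖ / 3 := by
    rw [norm_mul, n3]
    linarith
  have ultra : ∀ {x y z : ℚ_[3]} {r : ℝ}, ‖x‖ ≤ r → ‖y‖ ≤ r → ‖z‖ ≤ r → ‖x + y + z‖ ≤ r :=
    fun hx hy hz => (Padic.nonarchimedean _ _).trans
      (max_le ((Padic.nonarchimedean _ _).trans (max_le hx hy)) hz)
  have cube : ∀ {r s : ℝ}, 0 ≤ r → r ≤ s → r ^ 3 ≤ s ^ 3 := fun h0 h => pow_le_pow_left₀ h0 h 3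
  have pa := norm_nonneg α
  have pb := norm_nonneg β
  have pc := norm_nonneg γ
  have prod : ∀ {r s t : ℝ}, ‖α‖ ≤ r → ‖β‖ ≤ s → ‖γ‖ ≤ t → ‖α‖ * ‖β‖ * ‖γ‖ ≤ r * s * t :=
    fun h1 h2 h3 => mul_le_mul (mul_le_mul h1 h2 pb (pa.trans h1)) h3 pc
      (mul_nonneg (pa.trans h1) (pb.trans h2))
  -- `m` is the coefficient size that dominates, ties going to the lower power of $v$. The matching
  -- term among $N(a)$, $3N(b)$, $9N(c)$ is strictly larger than the rest, so the vanishing of the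
  -- sum forces `m` to be zero.
  have main : ∃ m : ℚ_[3], ‖m‖ ≤ 0 ∧ ‖α‖ ≤ ‖m‖ ∧ ‖β‖ ≤ ‖m‖ ∧ ‖γ‖ ≤ ‖m‖ := by
    by_cases c1 : ‖β‖ ≤ ‖α‖ ∧ ‖γ‖ ≤ ‖α‖
    · refine ⟨α, ?_, le_rfl, c1.1, c1.2⟩
      have b1 := cube pb c1.1
      have b2 := cube pc c1.2
      have b3 := prod le_rfl c1.1 c1.2
      have e : ι sa = -(3 * ι sb) + -(9 * ι sc) + 3 * ι t := by linear_combination h4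
      have := ultra (r := ‖α‖ ^ 3 / 3) (x := -(3 * ι sb)) (y := -(9 * ι sc)) (z := 3 * ι t)
        (by rw [norm_neg, m1]; linarith)
        (by rw [norm_neg, m2]; linarith [pow_nonneg pc 3]) (by linarith)
      rw [← e, hsa'] at this
      by_contra hp
      linarith [pow_pos (not_le.1 hp) 3]
    by_cases c2 : ‖α‖ < ‖β‖ ∧ ‖γ‖ ≤ ‖β‖
    · refine ⟨β, ?_, c2.1.le, le_rfl, c2.2⟩
      -- Without this factor 3 the trace term would only be bounded by $\|\beta\|^3/3$, the size of
      -- $3N(b)$ itself.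
      have c3 : ‖α‖ ≤ ‖β‖ / 3 := by linarith [Padic.three_mul_norm_le c2.1]
      have b1 := cube pa c3
      have b2 := cube pc c2.2
      have b3 := prod c3 le_rfl c2.2
      have e : 3 * ι sb = -ι sa + -(9 * ι sc) + 3 * ι t := by linear_combination h4
      have := ultra (r := ‖β‖ ^ 3 / 9) (x := -ι sa) (y := -(9 * ι sc)) (z := 3 * ι t)
        (by rw [norm_neg, hsa']; linarith [pow_nonneg pb 3])
        (by rw [norm_neg, m2]; linarith) (by linarith)
      rw [← e, m1] at this
      by_contra hp
      linarith [pow_pos (not_le.1 hp) 3]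
    · have c3 : ‖α‖ < ‖γ‖ ∧ ‖β‖ < ‖γ‖ := by
        by_contra hcon
        rcases le_total ‖β‖ ‖γ‖ with h5 | h5 <;> grind
      refine ⟨γ, ?_, c3.1.le, c3.2.le, le_rfl⟩
      have c4 : ‖α‖ ≤ ‖γ‖ / 3 := by linarith [Padic.three_mul_norm_le c3.1]
      have c5 : ‖β‖ ≤ ‖γ‖ / 3 := by linarith [Padic.three_mul_norm_le c3.2]
      have b1 := cube pa c4
      have b2 := cube pb c5
      have b3 := prod c4 c5 le_rfl
      have e : 9 * ι sc = -ι sa + -(3 * ι sb) + 3 * ι t := by linear_combination h4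
      have := ultra (r := ‖γ‖ ^ 3 / 27) (x := -ι sa) (y := -(3 * ι sb)) (z := 3 * ι t)
        (by rw [norm_neg, hsa']; linarith)
        (by rw [norm_neg, m1]; linarith [pow_nonneg pc 3]) (by linarith)
      rw [← e, m2] at this
      by_contra hp
      linarith [pow_pos (not_le.1 hp) 3]
  obtain ⟨m, hm, h5, h6, h7⟩ := main
  apply hx
  ext
  · exact hα (norm_le_zero_iff.1 (h5.trans hm))
  · exact hβ (norm_le_zero_iff.1 (h6.trans hm))
  · exact hγ (norm_le_zero_iff.1 (h7.trans hm))

end IsCubicGenerator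

end CubicBasis

/-! ### Positive definite Hermitian matrices and adjoints -/

section PositiveDefinite

open scoped ComplexOrder MatrixOrder Matrix.Norms.L2Operator

/-- Writing $S=C^*C$, conjugation by $C$ turns $Y$ into the ordinary conjugate transpose of
$CXC^{-1}$, so the trace is the squared Frobenius norm of a nonzero matrix. -/
theorem Matrix.PosDef.trace_mul_pos_of_adjoint {n : Type*} [Fintype n] [DecidableEq n]
    {S X Y : Matrix n n ℂ} (hS : S.PosDef) (hXY : S * Y = X.conjTranspose * S) (hX : X ≠ 0) :
    0 < (Y * X).trace := by
  obtain ⟨C, hC, rfl⟩ := CStarAlgebra.isStrictlyPositive_iff_eq_star_mul_self.mp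
    hS.isStrictlyPositive
  obtain ⟨⟨C, D, hCD, hDC⟩, rfl⟩ := hC
  simp only [Matrix.star_eq_conjTranspose] at hXY
  have h1 : D.conjTranspose * C.conjTranspose = 1 := by
    rw [← Matrix.conjTranspose_mul, hCD, Matrix.conjTranspose_one]
  have h2 : C * Y * D = (C * X * D).conjTranspose := by
    calc C * Y * D = D.conjTranspose * C.conjTranspose * (C * Y * D) := by rw [h1, one_mul]
      _ = D.conjTranspose * (C.conjTranspose * C * Y) * D := by noncomm_ring
      _ = D.conjTranspose * X.conjTranspose * C.conjTranspose * (C * D) := by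
        rw [hXY]
        noncomm_ring
      _ = _ := by
        rw [hCD, mul_one, Matrix.conjTranspose_mul, Matrix.conjTranspose_mul, mul_assoc]
  have h3 : (Y * X).trace = ((C * X * D).conjTranspose * (C * X * D)).trace := by
    calc (Y * X).trace = (Y * X * (D * C)).trace := by rw [hDC, mul_one]
      _ = (C * (Y * X * D)).trace := by rw [← mul_assoc, Matrix.trace_mul_comm]
      _ = (C * (Y * (D * C) * X * D)).trace := by rw [hDC, mul_one]
      _ = (C * Y * D * (C * X * D)).trace := by
        congr 1
        noncomm_ring
      _ = _ := by rw [h2]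
  rw [h3]
  refine lt_of_le_of_ne (Matrix.posSemidef_conjTranspose_mul_self _).trace_nonneg (Ne.symm ?_)
  rw [Ne, Matrix.trace_conjTranspose_mul_self_eq_zero_iff]
  intro h4
  apply hX
  calc X = D * C * X * (D * C) := by rw [hDC, one_mul, mul_one]
    _ = D * (C * X * D) * C := by noncomm_ring
    _ = 0 := by rw [h4, mul_zero, zero_mul]

/-- This is the matrix $S=HM(t)$ with `P` and `s` the images of $p$ and $\sigma(p)$; the diagonal
outweighs the off-diagonal terms. -/
theorem posDef_of_bounds {P : ℝ} {s : ℂ} (hP : 3 ≤ P) (hs : ‖s‖ ≤ 3 / 5) :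
    (!![(P : ℂ), 3 * (starRingEnd ℂ) s, 3 * s; 3 * s, 3 * P, 3 * (starRingEnd ℂ) s;
      3 * (starRingEnd ℂ) s, 3 * s, 9 * P]).PosDef := by
  have hH : (!![(P : ℂ), 3 * (starRingEnd ℂ) s, 3 * s; 3 * s, 3 * P, 3 * (starRingEnd ℂ) s;
      3 * (starRingEnd ℂ) s, 3 * s, 9 * P]).IsHermitian := by
    ext i j
    fin_cases i <;> fin_cases j <;> simp [Matrix.conjTranspose_apply]
  refine Matrix.PosDef.of_dotProduct_mulVec_pos hH fun x hx => ?_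
  refine RCLike.pos_iff.2 ⟨?_, hH.im_star_dotProduct_mulVec_self x⟩
  have hre : ∀ w : ℂ, -‖w‖ ≤ w.re := fun w => (abs_le.1 (Complex.abs_re_le_norm w)).1
  have h01 := hre ((starRingEnd ℂ) (x 0) * (starRingEnd ℂ) s * x 1)
  have h02 := hre ((starRingEnd ℂ) (x 0) * s * x 2)
  have h12 := hre ((starRingEnd ℂ) (x 1) * (starRingEnd ℂ) s * x 2)
  have hsum : star x ⬝ᵥ (!![(P : ℂ), 3 * (starRingEnd ℂ) s, 3 * s; 3 * s, 3 * P,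
      3 * (starRingEnd ℂ) s; 3 * (starRingEnd ℂ) s, 3 * s, 9 * P]).mulVec x =
      P * (x 0 * (starRingEnd ℂ) (x 0)) + 3 * P * (x 1 * (starRingEnd ℂ) (x 1)) +
      9 * P * (x 2 * (starRingEnd ℂ) (x 2)) +
      3 * (((starRingEnd ℂ) (x 0) * (starRingEnd ℂ) s * x 1) +
        (starRingEnd ℂ) ((starRingEnd ℂ) (x 0) * (starRingEnd ℂ) s * x 1)) +
      3 * (((starRingEnd ℂ) (x 0) * s * x 2) +
        (starRingEnd ℂ) ((starRingEnd ℂ) (x 0) * s * x 2)) +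
      3 * (((starRingEnd ℂ) (x 1) * (starRingEnd ℂ) s * x 2) +
        (starRingEnd ℂ) ((starRingEnd ℂ) (x 1) * (starRingEnd ℂ) s * x 2)) := by
    simp [Matrix.mulVec, dotProduct, Fin.sum_univ_three]
    ring
  have hval : RCLike.re (star x ⬝ᵥ (!![(P : ℂ), 3 * (starRingEnd ℂ) s, 3 * s; 3 * s, 3 * P,
      3 * (starRingEnd ℂ) s; 3 * (starRingEnd ℂ) s, 3 * s, 9 * P]).mulVec x) =
      P * ‖x 0‖ ^ 2 + 3 * P * ‖x 1‖ ^ 2 + 9 * P * ‖x 2‖ ^ 2 +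
      6 * ((starRingEnd ℂ) (x 0) * (starRingEnd ℂ) s * x 1).re +
      6 * ((starRingEnd ℂ) (x 0) * s * x 2).re +
      6 * ((starRingEnd ℂ) (x 1) * (starRingEnd ℂ) s * x 2).re := by
    rw [hsum]
    simp only [Complex.add_conj, Complex.mul_conj]
    norm_cast
    rw [RCLike.re_eq_complex_re, Complex.ofReal_re]
    simp only [Complex.normSq_eq_norm_sq]
    ring
  rw [hval]
  simp only [norm_mul, RCLike.norm_conj] at h01 h02 h12
  have hpos : 0 < ‖x 0‖ ∨ 0 < ‖x 1‖ ∨ 0 < ‖x 2‖ := by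
    by_contra hcon
    simp only [not_or, norm_pos_iff, not_not] at hcon
    apply hx
    funext i
    fin_cases i
    · exact hcon.1
    · exact hcon.2.1
    · exact hcon.2.2
  have b01 : ‖x 0‖ * ‖s‖ * ‖x 1‖ ≤ ‖x 0‖ * (3 / 5) * ‖x 1‖ := by gcongr
  have b02 : ‖x 0‖ * ‖s‖ * ‖x 2‖ ≤ ‖x 0‖ * (3 / 5) * ‖x 2‖ := by gcongr
  have b12 : ‖x 1‖ * ‖s‖ * ‖x 2‖ ≤ ‖x 1‖ * (3 / 5) * ‖x 2‖ := by gcongr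
  have q0 : 3 * ‖x 0‖ ^ 2 ≤ P * ‖x 0‖ ^ 2 := by gcongr
  have q1 : 3 * ‖x 1‖ ^ 2 ≤ P * ‖x 1‖ ^ 2 := by gcongr
  have q2 : 3 * ‖x 2‖ ^ 2 ≤ P * ‖x 2‖ ^ 2 := by gcongr
  have hsq : 0 < ‖x 0‖ ^ 2 + ‖x 1‖ ^ 2 + ‖x 2‖ ^ 2 := by
    rcases hpos with h | h | h <;> positivity
  -- With weights 0.3, 0.3 and 1.8 these squares absorb the cross terms, each of coefficient $6\cdot
  -- 3/5=3.6$, and leave positive multiples of the three squared norms.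
  nlinarith [sq_nonneg (2 * ‖x 0‖ - 3 * ‖x 1‖), sq_nonneg (2 * ‖x 0‖ - 3 * ‖x 2‖),
    sq_nonneg (‖x 1‖ - ‖x 2‖)]

end PositiveDefinite

/-! ### Twisting an anti-involution -/

section Involutions

/-- Twisting an anti-involution by a fixed unit gives an anti-involution. -/
theorem IsAntiInvolution.exists_twist {B : Type*} [Ring B] [Algebra ℚ B] {φ : B →ₗ[ℚ] B}
    (hφ : IsAntiInvolution φ) (t : Bˣ) (ht : φ t = t) :
    ∃ ψ : B →ₗ[ℚ] B, IsAntiInvolution ψ ∧ ∀ x, ψ x = ↑t⁻¹ * φ x * t := by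
  refine ⟨LinearMap.mulRight ℚ (t : B) ∘ₗ LinearMap.mulLeft ℚ ((t⁻¹ : Bˣ) : B) ∘ₗ φ, ?_,
    fun x => rfl⟩
  have hinv : φ ((t⁻¹ : Bˣ) : B) = ((t⁻¹ : Bˣ) : B) := by
    have h1 : (t : B) * φ ((t⁻¹ : Bˣ) : B) = 1 := by
      rw [← hφ.map_one, ← Units.inv_mul t, hφ.map_mul, ht]
    exact (Units.inv_eq_of_mul_eq_one_right h1).symm
  constructor
  · simp [hφ.map_one]
  · intro x
    simp [hφ.map_mul, hφ.involutive, hinv, ht, mul_assoc]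
  · intro x y
    simp [hφ.map_mul, mul_assoc]

end Involutions

/-! ### Traces and the representation by complex matrices -/

namespace CubicCyclicAlgebra

variable {F E : Type*} [Field F] [Field E] [Algebra F E]

/-- Relative to $E\oplus vE\oplus v^2E$ the diagonal blocks of left multiplication by `y` are
multiplication by $c_0$, $\sigma c_0$ and $\sigma^2c_0$. -/
theorem trace_mulLeft [Algebra ℚ F] [Algebra ℚ E] [IsScalarTower ℚ F E] [FiniteDimensional ℚ E]
    {σ : E ≃ₐ[F] E} {hσ : σ ^ 3 = 1} {u : F} (y : CubicCyclicAlgebra σ hσ u) :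
    LinearMap.trace ℚ (CubicCyclicAlgebra σ hσ u) (LinearMap.mulLeft ℚ y) =
      Algebra.trace ℚ E (y.c0 + σ y.c0 + σ (σ y.c0)) := by
  have : Module.Finite ℚ (CubicCyclicAlgebra σ hσ u) := Module.Finite.equiv (coeffEquiv ℚ).symm
  let ε : CubicCyclicAlgebra σ hσ u ≃ₗ[ℚ] E × E × E := coeffEquiv ℚ
  let p0 : CubicCyclicAlgebra σ hσ u →ₗ[ℚ] E := LinearMap.fst ℚ E (E × E) ∘ₗ ε.toLinearMap
  let p1 : CubicCyclicAlgebra σ hσ u →ₗ[ℚ] E :=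
    LinearMap.fst ℚ E E ∘ₗ LinearMap.snd ℚ E (E × E) ∘ₗ ε.toLinearMap
  let p2 : CubicCyclicAlgebra σ hσ u →ₗ[ℚ] E :=
    LinearMap.snd ℚ E E ∘ₗ LinearMap.snd ℚ E (E × E) ∘ₗ ε.toLinearMap
  let i0 : E →ₗ[ℚ] CubicCyclicAlgebra σ hσ u :=
    ε.symm.toLinearMap ∘ₗ LinearMap.inl ℚ E (E × E)
  let i1 : E →ₗ[ℚ] CubicCyclicAlgebra σ hσ u :=
    ε.symm.toLinearMap ∘ₗ LinearMap.inr ℚ E (E × E) ∘ₗ LinearMap.inl ℚ E E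
  let i2 : E →ₗ[ℚ] CubicCyclicAlgebra σ hσ u :=
    ε.symm.toLinearMap ∘ₗ LinearMap.inr ℚ E (E × E) ∘ₗ LinearMap.inr ℚ E E
  let f := LinearMap.mulLeft ℚ y
  have hf : f = (f ∘ₗ i0) ∘ₗ p0 + (f ∘ₗ i1) ∘ₗ p1 + (f ∘ₗ i2) ∘ₗ p2 := by
    refine LinearMap.ext fun x => ?_
    have hx : x = i0 (p0 x) + i1 (p1 x) + i2 (p2 x) := by
      ext <;> simp [i0, i1, i2, p0, p1, p2, ε, coeffEquiv]
    simp only [LinearMap.add_apply, LinearMap.comp_apply]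
    rw [← map_add, ← map_add, ← hx]
  have h0 : p0 ∘ₗ f ∘ₗ i0 = LinearMap.mulLeft ℚ y.c0 := by
    refine LinearMap.ext fun e => ?_
    simp [p0, f, i0, ε, coeffEquiv]
  have h1 : p1 ∘ₗ f ∘ₗ i1 = LinearMap.mulLeft ℚ (σ y.c0) := by
    refine LinearMap.ext fun e => ?_
    simp [p1, f, i1, ε, coeffEquiv]
  have h2 : p2 ∘ₗ f ∘ₗ i2 = LinearMap.mulLeft ℚ (σ (σ y.c0)) := by
    refine LinearMap.ext fun e => ?_
    simp [p2, f, i2, ε, coeffEquiv]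
  change LinearMap.trace ℚ _ f = _
  rw [hf, map_add, map_add, LinearMap.trace_comp_comm' p0,
    LinearMap.trace_comp_comm' p1, LinearMap.trace_comp_comm' p2, h0, h1, h2, map_add, map_add]
  rfl

section Matrix

variable {σ : E ≃ₐ[F] E} {hσ : σ ^ 3 = 1}

/-- The matrix of left multiplication on the right `E`-space with basis `1, v, v²`, mapped to
`ℂ` by `j`. -/
def toMatrix (j : E →+* ℂ) (x : CubicCyclicAlgebra σ hσ (3 : F)) : Matrix (Fin 3) (Fin 3) ℂ :=
  !![j x.c0, 3 * j (σ x.c2), 3 * j (σ (σ x.c1));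
    j x.c1, j (σ x.c0), 3 * j (σ (σ x.c2));
    j x.c2, j (σ x.c1), j (σ (σ x.c0))]

theorem toMatrix_mul (j : E →+* ℂ) (x y : CubicCyclicAlgebra σ hσ (3 : F)) :
    toMatrix j (x * y) = toMatrix j x * toMatrix j y := by
  ext i k
  fin_cases i <;> fin_cases k <;>
    simp [toMatrix, Matrix.mul_apply, Fin.sum_univ_three, apply_three hσ, map_ofNat] <;> ring

theorem toMatrix_ne_zero (j : E →+* ℂ) {x : CubicCyclicAlgebra σ hσ (3 : F)} (hx : x ≠ 0) :
    toMatrix j x ≠ 0 := by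
  contrapose! hx
  have h0 := congrFun (congrFun hx 0) 0
  have h1 := congrFun (congrFun hx 1) 0
  have h2 := congrFun (congrFun hx 2) 0
  simp [toMatrix] at h0 h1 h2
  ext <;> assumption

theorem trace_toMatrix (j : E →+* ℂ) (x : CubicCyclicAlgebra σ hσ (3 : F)) :
    (toMatrix j x).trace = j (x.c0 + σ x.c0 + σ (σ x.c0)) := by
  simp [toMatrix, Matrix.trace, Fin.sum_univ_three]

end Matrix

end CubicCyclicAlgebra

/-! ### The positive anti-involution of the second kind -/

section Conjugation

open scoped ComplexOrder

variable {F E : Type*} [Field F] [Field E] [Algebra F E] [Algebra ℚ F] [Algebra ℚ E]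

/-- The automorphism `τ` is complex conjugation with respect to `j`; together with `σ` it generates
a nonabelian group of order six. The field `F` is an imaginary quadratic field `ℚ(δ)`. -/
structure IsDihedralConjugation (j : E →+* ℂ) (τ : E ≃ₐ[ℚ] E) (σ : E ≃ₐ[F] E) (δ : F) : Prop where
  map_conj : ∀ e, j (τ e) = (starRingEnd ℂ) (j e)
  conj_apply : ∀ e, τ (σ e) = σ (σ (τ e))
  conj_gen : τ (algebraMap F E δ) = -algebraMap F E δ
  gen_ne_zero : δ ≠ 0
  span : ∀ a : F, ∃ p q : ℚ, a = algebraMap ℚ F p + algebraMap ℚ F q * δ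

namespace IsDihedralConjugation

variable {j : E →+* ℂ} {τ : E ≃ₐ[ℚ] E} {σ : E ≃ₐ[F] E} {δ : F}
  (h : IsDihedralConjugation j τ σ δ)
include h

theorem conj_conj (e : E) : τ (τ e) = e := by
  apply j.injective
  rw [h.map_conj, h.map_conj, Complex.conj_conj]

/-- The generator `δ` contributes to neither side: `τ` negates it, so its trace is zero and its
image under `j` is purely imaginary. -/
theorem trace_algebraMap [IsScalarTower ℚ F E] (a : F) :
    (Algebra.trace ℚ E (algebraMap F E a) : ℝ) = Module.finrank ℚ E * (j (algebraMap F E a)).re := by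
  obtain ⟨p, q, rfl⟩ := h.span a
  have h1 : Algebra.trace ℚ E (algebraMap F E δ) = 0 := by
    have h2 := Algebra.trace_eq_of_algEquiv τ (algebraMap F E δ)
    rw [h.conj_gen, map_neg] at h2
    linarith
  have h3 : (j (algebraMap F E δ)).re = 0 := by
    have h4 := congrArg Complex.re (h.map_conj (algebraMap F E δ))
    rw [h.conj_gen, map_neg] at h4
    simp at h4
    linarith
  have h5 : algebraMap F E (algebraMap ℚ F p + algebraMap ℚ F q * δ) =
      algebraMap ℚ E p + q • algebraMap F E δ := by
    rw [map_add, map_mul, ← IsScalarTower.algebraMap_apply, ← IsScalarTower.algebraMap_apply,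
      Algebra.smul_def]
  rw [h5, map_add, map_smul, h1, Algebra.trace_algebraMap, Algebra.smul_def]
  have h6 : (j (q • algebraMap F E δ)).re = 0 := by
    rw [Algebra.smul_def, map_mul, eq_ratCast, map_ratCast]
    simp [h3]
  simp [h6]

variable {hσ : σ ^ 3 = 1}

/-- The map is `τ` on $E$ and fixes $v$; the powers of `σ` come from moving $\tau(c_i)v^i$ into the
form $v^i\sigma^i\tau(c_i)$. Products reverse because $\tau\sigma=\sigma^{-1}\tau$ and $v^3=3$ is
rational. -/
theorem exists_isAntiInvolution [IsScalarTower ℚ F E] :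
    ∃ φ : CubicCyclicAlgebra σ hσ (3 : F) →ₗ[ℚ] CubicCyclicAlgebra σ hσ (3 : F),
      IsAntiInvolution φ ∧ ∀ x, φ x = ⟨τ x.c0, σ (τ x.c1), σ (σ (τ x.c2))⟩ := by
  have hs : ∀ (q : ℚ) (e : E), σ (q • e) = q • σ e := fun q e => by
    rw [Algebra.smul_def, Algebra.smul_def, IsScalarTower.algebraMap_apply ℚ F E, map_mul,
      AlgEquiv.commutes]
  refine ⟨⟨⟨fun x => ⟨τ x.c0, σ (τ x.c1), σ (σ (τ x.c2))⟩, fun x y => by ext <;> simp⟩,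
    fun q x => by ext <;> simp [hs]⟩, ⟨?_, fun x => ?_, fun x y => ?_⟩, fun x => rfl⟩
  · ext <;> simp
  · ext <;> simp [h.conj_apply, h.conj_conj, CubicCyclicAlgebra.apply_three hσ]
  · ext <;> simp [h.conj_apply, CubicCyclicAlgebra.apply_three hσ, map_ofNat] <;> ring

/-- The Hermitian form with respect to which the anti-involution of `exists_isAntiInvolution` is
the adjoint. -/
theorem hermitian_mul_toMatrix (x : CubicCyclicAlgebra σ hσ (3 : F)) :
    !![1, 0, 0; 0, 0, 3; 0, 3, 0] * CubicCyclicAlgebra.toMatrix j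
        (⟨τ x.c0, σ (τ x.c1), σ (σ (τ x.c2))⟩ : CubicCyclicAlgebra σ hσ (3 : F)) =
      (CubicCyclicAlgebra.toMatrix j x).conjTranspose * !![1, 0, 0; 0, 0, 3; 0, 3, 0] := by
  ext i k
  fin_cases i <;> fin_cases k <;>
    simp [CubicCyclicAlgebra.toMatrix, Matrix.mul_apply, Fin.sum_univ_three, ← h.map_conj,
      h.conj_apply, CubicCyclicAlgebra.apply_three hσ, map_ofNat] <;> ring

theorem exists_isPositiveAntiInvolution [IsScalarTower ℚ F E] [FiniteDimensional ℚ E]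
    (hspan : ∀ e : E, ∃ s : F, e + σ e + σ (σ e) = algebraMap F E s)
    (hdiv : ∀ x : CubicCyclicAlgebra σ hσ (3 : F), x ≠ 0 → IsUnit x)
    (p : E) (hp : τ p = p) (hp3 : 3 ≤ (j p).re) (hps : ‖j (σ p)‖ ≤ 3 / 5) :
    ∃ φ : CubicCyclicAlgebra σ hσ (3 : F) →ₗ[ℚ] CubicCyclicAlgebra σ hσ (3 : F),
      IsPositiveAntiInvolution φ ∧ IsOfSecondKind φ := by
  obtain ⟨φ₀, hφ₀, hφ₀'⟩ := h.exists_isAntiInvolution (hσ := hσ)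
  have hp0 : p ≠ 0 := by
    rintro rfl
    norm_num at hp3
  -- The coefficients make $t$ fixed by `φ₀` and put $p$, $3p$, $9p$ on the diagonal of $HM(t)$,
  -- with multiples of $\sigma(p)$ and its conjugate elsewhere.
  obtain ⟨t, ht⟩ := hdiv ⟨p, σ (σ p), σ p⟩ fun h0 => hp0 (congrArg CubicCyclicAlgebra.c0 h0)
  have hfix : φ₀ t = t := by
    rw [ht, hφ₀']
    ext <;> simp [h.conj_apply, hp, CubicCyclicAlgebra.apply_three hσ]
  obtain ⟨φ, hφ, hφ'⟩ := hφ₀.exists_twist t hfix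
  have hpre : ((j p).re : ℂ) = j p := by
    rw [← Complex.conj_eq_iff_re, ← h.map_conj, hp]
  have hS : (!![1, 0, 0; 0, 0, 3; 0, 3, 0] * CubicCyclicAlgebra.toMatrix j
      (t : CubicCyclicAlgebra σ hσ (3 : F))).PosDef := by
    convert posDef_of_bounds hp3 hps using 1
    rw [hpre, ht]
    ext i k
    fin_cases i <;> fin_cases k <;>
      simp [CubicCyclicAlgebra.toMatrix, Matrix.mul_apply, Fin.sum_univ_three, ← h.map_conj,
        h.conj_apply, hp, CubicCyclicAlgebra.apply_three hσ]
    ring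
  refine ⟨φ, ⟨hφ, fun x hx => ?_⟩, ?_⟩
  · have hadj : (!![1, 0, 0; 0, 0, 3; 0, 3, 0] * CubicCyclicAlgebra.toMatrix j
        (t : CubicCyclicAlgebra σ hσ (3 : F))) * CubicCyclicAlgebra.toMatrix j (φ x) =
        (CubicCyclicAlgebra.toMatrix j x).conjTranspose * (!![1, 0, 0; 0, 0, 3; 0, 3, 0] *
          CubicCyclicAlgebra.toMatrix j (t : CubicCyclicAlgebra σ hσ (3 : F))) := by
      rw [mul_assoc, ← CubicCyclicAlgebra.toMatrix_mul, hφ', ← mul_assoc, ← mul_assoc,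
        Units.mul_inv, one_mul, CubicCyclicAlgebra.toMatrix_mul, ← mul_assoc, hφ₀',
        h.hermitian_mul_toMatrix, mul_assoc]
    have hpos := (hS.trace_mul_pos_of_adjoint hadj
      (CubicCyclicAlgebra.toMatrix_ne_zero j hx))
    rw [← CubicCyclicAlgebra.toMatrix_mul, CubicCyclicAlgebra.trace_toMatrix] at hpos
    obtain ⟨s, hs⟩ := hspan (φ x * x).c0
    rw [CubicCyclicAlgebra.trace_mulLeft, hs]
    rw [hs] at hpos
    have h1 := h.trace_algebraMap s
    have h2 : (0 : ℝ) < Module.finrank ℚ E := by exact_mod_cast Module.finrank_pos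
    have h3 : (0 : ℝ) < (Algebra.trace ℚ E (algebraMap F E s) : ℝ) := by
      rw [h1]
      exact mul_pos h2 (Complex.pos_iff.1 hpos).1
    exact_mod_cast h3
  -- The witness for the second kind is `δ`: it is central, so the twist by `t` does not affect
  -- $\varphi_0(\delta)=-\delta$.
  · have hc : ∀ y : CubicCyclicAlgebra σ hσ (3 : F),
        y * ⟨algebraMap F E δ, 0, 0⟩ = ⟨algebraMap F E δ, 0, 0⟩ * y := fun y =>
      (Algebra.commutes δ y).symm
    refine ⟨⟨algebraMap F E δ, 0, 0⟩, Subalgebra.mem_center_iff.2 hc, fun heq => ?_⟩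
    have hn : φ₀ ⟨algebraMap F E δ, 0, 0⟩ = -⟨algebraMap F E δ, 0, 0⟩ := by
      rw [hφ₀']
      ext <;> simp [h.conj_gen]
    rw [hφ', hn, mul_neg, neg_mul, hc, mul_assoc, Units.inv_mul, mul_one] at heq
    have h1 := congrArg CubicCyclicAlgebra.c0 heq
    rw [CubicCyclicAlgebra.neg_c0, neg_eq_iff_add_eq_zero, ← two_mul] at h1
    have : CharZero E := charZero_of_injective_algebraMap (algebraMap ℚ E).injective
    simp [h.gen_ne_zero] at h1

end IsDihedralConjugation

end Conjugation

/-! ### Simple extensions: homomorphisms and coordinates -/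

section SimpleExtension

open Polynomial IntermediateField

variable {K L : Type*} [Field K] [Field L] [Algebra K L]

theorem IntermediateField.exists_algHom_adjoin_simple {M : Type*} [Field M] [Algebra K M] {x : L}
    {f : K[X]} (hf : f.Monic) (hirr : Irreducible f) (hx : aeval x f = 0) {y : M}
    (hy : aeval y f = 0) : ∃ g : K⟮x⟯ →ₐ[K] M, g (AdjoinSimple.gen K x) = y := by
  have hmin : minpoly K x = f := (minpoly.eq_of_irreducible_of_monic hirr hx hf).symm
  have hint : IsIntegral K x := ⟨f, hf, hx⟩
  exact ⟨_, algHomAdjoinIntegralEquiv_symm_apply_gen K hint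
    ⟨y, mem_aroots.2 ⟨minpoly.ne_zero hint, by rwa [hmin]⟩⟩⟩

theorem IntermediateField.exists_eq_aeval_of_mem_adjoin_simple {x y : L} {f : K[X]} (hf : f.Monic)
    (hx : aeval x f = 0) (hy : y ∈ K⟮x⟯) : ∃ g : K[X], g.degree < f.degree ∧ y = aeval x g := by
  have hint : IsIntegral K x := ⟨f, hf, hx⟩
  rw [← mem_toSubalgebra, adjoin_simple_toSubalgebra_of_isAlgebraic hint.isAlgebraic,
    Algebra.adjoin_singleton_eq_range_aeval] at hy
  obtain ⟨p, rfl⟩ := hy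
  refine ⟨p %ₘ f, degree_modByMonic_lt p hf, ?_⟩
  exact (aeval_modByMonic_eq_self_of_root hx).symm

theorem IntermediateField.exists_quadratic_of_mem_adjoin_simple {x y : L} {f : K[X]} (hf : f.Monic)
    (hdeg : f.natDegree ≤ 3) (hx : aeval x f = 0) (hy : y ∈ K⟮x⟯) :
    ∃ a b c : K, y = algebraMap K L a + algebraMap K L b * x + algebraMap K L c * x ^ 2 := by
  obtain ⟨g, hg, rfl⟩ := exists_eq_aeval_of_mem_adjoin_simple hf hx hy
  refine ⟨g.coeff 0, g.coeff 1, g.coeff 2, ?_⟩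
  have h3 : g.degree < (3 : ℕ) :=
    hg.trans_le (degree_le_natDegree.trans (by exact_mod_cast hdeg))
  have hnat : g.natDegree < 3 := by
    rcases eq_or_ne g 0 with rfl | hg0
    · simp
    · exact (natDegree_lt_iff_degree_lt hg0).2 h3
  rw [aeval_eq_sum_range' hnat]
  simp [Finset.sum_range_succ, Algebra.smul_def]

theorem IntermediateField.exists_linear_of_mem_adjoin_simple {x y : L} {f : K[X]} (hf : f.Monic)
    (hdeg : f.natDegree ≤ 2) (hx : aeval x f = 0) (hy : y ∈ K⟮x⟯) :
    ∃ a b : K, y = algebraMap K L a + algebraMap K L b * x := by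
  obtain ⟨g, hg, rfl⟩ := exists_eq_aeval_of_mem_adjoin_simple hf hx hy
  refine ⟨g.coeff 0, g.coeff 1, ?_⟩
  have h2 : g.degree < (2 : ℕ) :=
    hg.trans_le (degree_le_natDegree.trans (by exact_mod_cast hdeg))
  have hnat : g.natDegree < 2 := by
    rcases eq_or_ne g 0 with rfl | hg0
    · simp
    · exact (natDegree_lt_iff_degree_lt hg0).2 h2
  rw [aeval_eq_sum_range' hnat]
  simp [Finset.sum_range_succ, Algebra.smul_def]

end SimpleExtension

/-! ### The field $\mathbb{Q}(\sqrt{-23})$ -/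

section QuadraticField

open Polynomial IntermediateField

theorem sqrt_mul_I_sq : (((Real.sqrt 23 : ℝ) : ℂ) * Complex.I) ^ 2 = -23 := by
  rw [mul_pow, Complex.I_sq, ← Complex.ofReal_pow, Real.sq_sqrt (by norm_num)]
  norm_num

theorem monic_X_sq_add_twentythree : (X ^ 2 + C 23 : ℚ[X]).Monic := by
  monicity!

theorem natDegree_X_sq_add_twentythree : (X ^ 2 + C 23 : ℚ[X]).natDegree = 2 := by
  compute_degree!

theorem irreducible_X_sq_add_twentythree : Irreducible (X ^ 2 + C 23 : ℚ[X]) := by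
  apply irreducible_of_degree_le_three_of_not_isRoot
  · rw [natDegree_X_sq_add_twentythree]
    decide
  · intro x hx
    simp at hx
    nlinarith [sq_nonneg x]

theorem fieldF_nonempty_ringHom_padic : Nonempty (fieldF →+* ℚ_[3]) := by
  obtain ⟨r, hr⟩ := Padic.exists_sq_eq_neg_twentythree
  obtain ⟨g, -⟩ := exists_algHom_adjoin_simple (K := ℚ) (L := ℂ) (M := ℚ_[3])
    (x := ((Real.sqrt 23 : ℝ) : ℂ) * Complex.I) (y := r) monic_X_sq_add_twentythree
    irreducible_X_sq_add_twentythree (by simp [sqrt_mul_I_sq, map_ofNat])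
    (by simp [hr, map_ofNat])
  exact ⟨g.toRingHom⟩

theorem exists_of_mem_fieldF {y : ℂ} (hy : y ∈ fieldF) :
    ∃ p q : ℚ, y = p + q * (((Real.sqrt 23 : ℝ) : ℂ) * Complex.I) := by
  obtain ⟨p, q, h⟩ := exists_linear_of_mem_adjoin_simple monic_X_sq_add_twentythree
    natDegree_X_sq_add_twentythree.le (by simp [sqrt_mul_I_sq, map_ofNat]) hy
  exact ⟨p, q, by simpa using h⟩

instance : FiniteDimensional ℚ fieldF :=
  adjoin.finiteDimensional ⟨_, monic_X_sq_add_twentythree, by simp [sqrt_mul_I_sq]⟩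

end QuadraticField

/-! ### The cubic and its roots -/

section Cubic

open Polynomial

theorem monic_X_cube_sub_X_sq_add_one {K : Type*} [Field K] : (X ^ 3 - X ^ 2 + 1 : K[X]).Monic := by
  monicity!

theorem natDegree_X_cube_sub_X_sq_add_one {K : Type*} [Field K] :
    (X ^ 3 - X ^ 2 + 1 : K[X]).natDegree = 3 := by
  compute_degree!

theorem irreducible_X_cube_sub_X_sq_add_one {K : Type*} [Field K] (ι : K →+* ℚ_[3]) :
    Irreducible (X ^ 3 - X ^ 2 + 1 : K[X]) := by
  apply irreducible_of_degree_le_three_of_not_isRoot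
  · rw [natDegree_X_cube_sub_X_sq_add_one]
    decide
  · intro x hx
    simp at hx
    -- The norm of $x-X$ is the value of the cubic at $x$; its size is at least 1 because the
    -- coefficient $-1$ is a unit.
    have h1 : cubicNormForm x (-1) 0 = 0 := by
      rw [cubicNormForm]
      linear_combination hx
    have h2 := norm_cubicNormForm (ι x) (-1) 0
    have h3 : cubicNormForm (ι x) (-1) 0 = 0 := by
      simpa [map_cubicNormForm] using congrArg ι h1
    rw [h3, norm_zero, eq_comm] at h2
    have h4 := eq_zero_of_pow_eq_zero h2
    have h5 : ‖(-1 : ℚ_[3])‖ ≤ 0 := h4 ▸ (le_max_left _ _).trans (le_max_right _ _)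
    norm_num at h5

theorem real_root_bounds {lam : ℝ} (h : lam ^ 3 - lam ^ 2 + 1 = 0) :
    -0.76 ≤ lam ∧ lam ≤ -0.74 := by
  constructor
  · by_contra hc
    -- Division of the cubic by $x+0.76$: the right side is minus its value at $-0.76$, and the
    -- quadratic quotient is positive.
    have h1 : (lam + 0.76) * (lam ^ 2 - 1.76 * lam + 1.3376) = 0.016576 := by linear_combination h
    nlinarith [sq_nonneg (lam - 0.88)]
  · by_contra hc
    have h1 : (lam + 0.74) * (lam ^ 2 - 1.74 * lam + 1.2876) = -0.047176 := by
      linear_combination h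
    nlinarith [sq_nonneg (lam - 0.87)]

section

variable {lam : ℝ} (hlam : lam ^ 3 - lam ^ 2 + 1 = 0) {z : ℂ} (hz : z ^ 3 - z ^ 2 + 1 = 0)
  (hne : z ≠ (lam : ℂ))
include hlam hz hne

theorem quadratic_of_root : z ^ 2 + z * lam + lam ^ 2 - z - lam = 0 := by
  have h1 : (lam : ℂ) ^ 3 - (lam : ℂ) ^ 2 + 1 = 0 := by exact_mod_cast congrArg Complex.ofReal hlam
  refine (mul_eq_zero.1 ?_).resolve_left (sub_ne_zero.2 hne)
  linear_combination hz - h1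

theorem conj_root : (starRingEnd ℂ) z = 1 - lam - z := by
  have hq := quadratic_of_root hlam hz hne
  obtain ⟨b1, b2⟩ := real_root_bounds hlam
  have hre := congrArg Complex.re hq
  have him := congrArg Complex.im hq
  simp [pow_two] at hre him
  have hz0 : z.im ≠ 0 := by
    intro h0
    rw [h0] at hre
    -- A real `z` would give $(2z+\lambda-1)^2=1+2\lambda-3\lambda^2$, which is negative for
    -- $\lambda$ near $-0.75$.
    nlinarith [sq_nonneg (2 * z.re + lam - 1)]
  have h2 : 2 * z.re = 1 - lam := by
    apply mul_right_cancel₀ hz0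
    linear_combination him
  apply Complex.ext
  · simp
    linarith
  · simp

theorem discriminant_root_sq :
    (((lam : ℂ) - z) * (z - (starRingEnd ℂ) z) * ((starRingEnd ℂ) z - lam)) ^ 2 = -23 := by
  have h1 : (lam : ℂ) ^ 3 - (lam : ℂ) ^ 2 + 1 = 0 := by exact_mod_cast congrArg Complex.ofReal hlam
  have hq := quadratic_of_root hlam hz hne
  rw [conj_root hlam hz hne]
  -- With $f=x^3-x^2+1$, the product of the differences from $\lambda$ is controlled by
  -- $f'(\lambda)=3\lambda^2-2\lambda$.
  have hA : ((lam : ℂ) - z) * (1 - lam - z - lam) = -(3 * (lam : ℂ) ^ 2 - 2 * lam) := by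
    linear_combination hq
  have hB : (z - (1 - lam - z)) ^ 2 = 1 - (3 * (lam : ℂ) ^ 2 - 2 * lam) := by
    linear_combination 4 * hq
  calc _ = (((lam : ℂ) - z) * (1 - lam - z - lam)) ^ 2 * (z - (1 - lam - z)) ^ 2 := by ring
    _ = _ := by
      rw [hA, hB]
      linear_combination (-27 * (lam : ℂ) ^ 3 + 27 * (lam : ℂ) ^ 2 + 23) * h1

/-- One has $|1-z|^2=(1-z)(1-\bar z)=\lambda^2$, and $0.76^2<3/5$. -/
theorem norm_one_sub_root_sq : ‖(1 - z) ^ 2‖ ≤ 3 / 5 := by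
  have hq := quadratic_of_root hlam hz hne
  obtain ⟨b1, b2⟩ := real_root_bounds hlam
  have h1 : ((‖1 - z‖ ^ 2 : ℝ) : ℂ) = ((lam ^ 2 : ℝ) : ℂ) := by
    rw [← Complex.normSq_eq_norm_sq, ← Complex.mul_conj, map_sub, map_one,
      conj_root hlam hz hne]
    push_cast
    linear_combination -hq
  rw [norm_pow, Complex.ofReal_inj.1 h1]
  nlinarith

end

end Cubic

/-! ### $E$ as a cyclic cubic extension of $F$ -/

section Splitting

open Polynomial IntermediateField

variable {lam : ℝ} (hlam : lam ^ 3 - lam ^ 2 + 1 = 0) {z : ℂ} (hz : z ^ 3 - z ^ 2 + 1 = 0)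
  (hne : z ≠ (lam : ℂ))
include hlam hz hne

theorem conj_mem_fieldE {x : ℂ} (hx : x ∈ fieldE lam z) : (starRingEnd ℂ) x ∈ fieldE lam z := by
  let c : ℂ →ₐ[ℚ] ℂ := (Complex.conjAe.restrictScalars ℚ).toAlgHom
  have h1 : (lam : ℂ) ∈ fieldE lam z := subset_adjoin _ _ (by simp)
  have h2 : z ∈ fieldE lam z := subset_adjoin _ _ (by simp)
  have h3 : fieldE lam z ≤ (fieldE lam z).comap c := by
    refine adjoin_le_iff.2 ?_
    rintro y (rfl | rfl)
    · change (starRingEnd ℂ) (lam : ℂ) ∈ fieldE lam z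
      rwa [Complex.conj_ofReal]
    · change (starRingEnd ℂ) y ∈ fieldE lam y
      rw [conj_root hlam hz hne]
      exact sub_mem (sub_mem (one_mem _) h1) h2
  exact h3 hx

theorem discriminant_root_eq :
    ((lam : ℂ) - z) * (z - (starRingEnd ℂ) z) * ((starRingEnd ℂ) z - lam) =
        ((Real.sqrt 23 : ℝ) : ℂ) * Complex.I ∨
      ((lam : ℂ) - z) * (z - (starRingEnd ℂ) z) * ((starRingEnd ℂ) z - lam) =
        -(((Real.sqrt 23 : ℝ) : ℂ) * Complex.I) :=
  sq_eq_sq_iff_eq_or_eq_neg.1 ((discriminant_root_sq hlam hz hne).trans sqrt_mul_I_sq.symm)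

theorem fieldF_le_fieldE : fieldF ≤ fieldE lam z := by
  have h1 : (lam : ℂ) ∈ fieldE lam z := subset_adjoin _ _ (by simp)
  have h2 : z ∈ fieldE lam z := subset_adjoin _ _ (by simp)
  have h3 := conj_mem_fieldE hlam hz hne h2
  have h4 : ((lam : ℂ) - z) * (z - (starRingEnd ℂ) z) * ((starRingEnd ℂ) z - lam) ∈
      fieldE lam z := mul_mem (mul_mem (sub_mem h1 h2) (sub_mem h2 h3)) (sub_mem h3 h1)
  refine adjoin_le_iff.2 ?_
  rintro y rfl
  rcases discriminant_root_eq hlam hz hne with h | h <;> rw [h] at h4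
  · exact h4
  · simpa using neg_mem h4

theorem discriminant_root_mem :
    ((lam : ℂ) - z) * (z - (starRingEnd ℂ) z) * ((starRingEnd ℂ) z - lam) ∈ fieldF := by
  have h1 : ((Real.sqrt 23 : ℝ) : ℂ) * Complex.I ∈ fieldF := subset_adjoin _ _ rfl
  rcases discriminant_root_eq hlam hz hne with h | h <;> rw [h]
  · exact h1
  · exact neg_mem h1

theorem fieldF_span_discriminant {y : ℂ} (hy : y ∈ fieldF) : ∃ p q : ℚ, y = p + q *
    (((lam : ℂ) - z) * (z - (starRingEnd ℂ) z) * ((starRingEnd ℂ) z - lam)) := by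
  obtain ⟨p, q, rfl⟩ := exists_of_mem_fieldF hy
  rcases discriminant_root_eq hlam hz hne with h | h <;> rw [h]
  · exact ⟨p, q, rfl⟩
  · exact ⟨p, -q, by push_cast; ring⟩

/-- The square root $d$ of the discriminant lies in $F$ and equals $f'(\lambda)(1-\lambda-2z)$ for
the cubic $f$, so $z$ is rational in $d$ and $\lambda$. -/
theorem extendScalars_eq_adjoin (hFE : fieldF ≤ fieldE lam z) :
    extendScalars hFE = adjoin fieldF {(lam : ℂ)} := by
  have hE : extendScalars hFE = adjoin fieldF {(lam : ℂ), z} := extendScalars_adjoin hFE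
  rw [hE]
  apply le_antisymm
  · refine adjoin_le_iff.2 ?_
    have h1 : (lam : ℂ) ∈ adjoin fieldF {(lam : ℂ)} := mem_adjoin_simple_self _ _
    rintro y (rfl | rfl)
    · exact h1
    · have hd : algebraMap fieldF ℂ ⟨_, discriminant_root_mem hlam hz hne⟩ ∈
          adjoin fieldF {(lam : ℂ)} := IntermediateField.algebraMap_mem _ _
      rw [IntermediateField.algebraMap_apply] at hd
      have hg : (3 * (lam : ℂ) ^ 2 - 2 * lam) ∈ adjoin fieldF {(lam : ℂ)} :=
        sub_mem (mul_mem (ofNat_mem _ 3) (pow_mem h1 2)) (mul_mem (ofNat_mem _ 2) h1)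
      have hg0 : (3 * (lam : ℂ) ^ 2 - 2 * lam) ≠ 0 := by
        obtain ⟨-, b2⟩ := real_root_bounds hlam
        have : 3 * lam ^ 2 - 2 * lam ≠ 0 := by nlinarith
        exact_mod_cast this
      have hq := quadratic_of_root hlam hz hne
      have hy : y = (1 - lam - (((lam : ℂ) - y) * (y - (starRingEnd ℂ) y) *
          ((starRingEnd ℂ) y - lam)) / (3 * (lam : ℂ) ^ 2 - 2 * lam)) / 2 := by
        have hfac : ((lam : ℂ) - y) * (y - (starRingEnd ℂ) y) * ((starRingEnd ℂ) y - lam) =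
            (3 * (lam : ℂ) ^ 2 - 2 * lam) * (1 - lam - 2 * y) := by
          rw [conj_root hlam hz hne]
          linear_combination (2 * y - 1 + lam) * hq
        rw [hfac, mul_div_cancel_left₀ _ hg0]
        ring
      rw [hy]
      exact div_mem (sub_mem (sub_mem (one_mem _) h1) (div_mem hd hg)) (ofNat_mem _ 2)
  · exact adjoin.mono _ _ _ (by simp)

/-- Irreducibility over $F$ gives an $F$-homomorphism with $\lambda\mapsto z$. It permutes the
roots, and fixing the square root of the discriminant makes the permutation even, hence the 3-cycle.
-/
theorem exists_cyclic_automorphism (hFE : fieldF ≤ fieldE lam z)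
    {l m n : extendScalars hFE} (hl : (l : ℂ) = lam) (hm : (m : ℂ) = z)
    (hn : (n : ℂ) = (starRingEnd ℂ) z) :
    ∃ σ : extendScalars hFE ≃ₐ[fieldF] extendScalars hFE, σ l = m ∧ σ m = n ∧ σ n = l := by
  obtain ⟨ι⟩ := fieldF_nonempty_ringHom_padic
  have hE := extendScalars_eq_adjoin hlam hz hne hFE
  have hmn : n = 1 - l - m := by
    apply Subtype.ext
    push_cast
    rw [hn, hl, hm, conj_root hlam hz hne]
  have hroot : (lam : ℂ) ^ 3 - (lam : ℂ) ^ 2 + 1 = 0 := by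
    exact_mod_cast congrArg Complex.ofReal hlam
  have hm3 : m ^ 3 - m ^ 2 + 1 = 0 := by
    apply Subtype.ext
    push_cast
    rw [hm, hz]
  have hq : m ^ 2 + m * l + l ^ 2 - m - l = 0 := by
    apply Subtype.ext
    push_cast
    rw [hl, hm, quadratic_of_root hlam hz hne]
  have hd : algebraMap fieldF (extendScalars hFE) ⟨_, discriminant_root_mem hlam hz hne⟩ =
      (l - m) * (m - n) * (n - l) := by
    apply Subtype.ext
    push_cast
    rw [hl, hm, hn]
    rfl
  have hd0 : (l - m) * (m - n) * (n - l) ≠ 0 := by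
    intro h0
    have h1 := discriminant_root_sq hlam hz hne
    have h2 := congrArg Subtype.val h0
    push_cast at h2
    rw [hl, hm, hn] at h2
    rw [h2] at h1
    norm_num at h1
  obtain ⟨g, hg⟩ := exists_algHom_adjoin_simple (K := fieldF) (L := ℂ) (x := (lam : ℂ)) (y := m)
    monic_X_cube_sub_X_sq_add_one (irreducible_X_cube_sub_X_sq_add_one ι)
    (by simpa using hroot) (by simpa using hm3)
  have : FiniteDimensional fieldF (adjoin fieldF {(lam : ℂ)}) :=
    adjoin.finiteDimensional ⟨_, monic_X_cube_sub_X_sq_add_one, by simpa using hroot⟩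
  have : FiniteDimensional fieldF (extendScalars hFE) :=
    Module.Finite.equiv (equivOfEq hE.symm).toLinearEquiv
  let s : extendScalars hFE →ₐ[fieldF] extendScalars hFE := g.comp (equivOfEq hE).toAlgHom
  have hsl : s l = m := by
    rw [← hg]
    change g _ = _
    congr 1
    exact Subtype.ext hl
  have hs1 : s n = 1 - m - s m := by
    rw [hmn, map_sub, map_sub, map_one, hsl]
  have hs2 : (s m - l) * (s m - n) = 0 := by
    have h1 := congrArg s hq
    simp only [map_sub, map_add, map_mul, map_pow, map_zero, hsl] at h1
    rw [hmn]
    linear_combination h1 - hq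
  have hsm : s m = n := by
    rcases mul_eq_zero.1 hs2 with h1 | h1
    -- Here `s` would swap `l` and `m` and so negate the square root of the discriminant, a nonzero
    -- element of $F$.
    · exfalso
      have h2 : s ((l - m) * (m - n) * (n - l)) = (l - m) * (m - n) * (n - l) := by
        rw [← hd, AlgHom.commutes]
      simp only [map_sub, map_mul, hsl, hs1, sub_eq_zero.1 h1] at h2
      apply hd0
      rw [hmn] at h2 ⊢
      linear_combination (-1 / 2 : extendScalars hFE) * h2
    · exact sub_eq_zero.1 h1
  refine ⟨AlgEquiv.ofBijective s (Algebra.IsAlgebraic.algHom_bijective s), hsl, hsm, ?_⟩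
  change s n = l
  rw [hs1, hsm, hmn]
  ring

end Splitting

/-! ### The theorem -/

theorem theorem6p7 (lam : ℝ) (hlam : lam ^ 3 - lam ^ 2 + 1 = 0)
    (z : ℂ) (hz : z ^ 3 - z ^ 2 + 1 = 0) (hz_ne : z ≠ (lam : ℂ)) :
    ∃ hFE : fieldF ≤ fieldE lam z,
    ∃ σ : IntermediateField.extendScalars hFE ≃ₐ[fieldF] IntermediateField.extendScalars hFE,
    ∃ hσ : σ ^ 3 = 1,
      (∃ a b c : IntermediateField.extendScalars hFE,
        (a : ℂ) = (lam : ℂ) ∧ (b : ℂ) = z ∧ (c : ℂ) = (starRingEnd ℂ) z ∧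
          σ a = b ∧ σ b = c ∧ σ c = a) ∧
      (∀ x : CubicCyclicAlgebra σ hσ (3 : fieldF), x ≠ 0 → IsUnit x) ∧
      Algebra.IsCentral fieldF (CubicCyclicAlgebra σ hσ (3 : fieldF)) ∧
      Module.finrank fieldF (CubicCyclicAlgebra σ hσ (3 : fieldF)) = 9 ∧
      ∃ φ : CubicCyclicAlgebra σ hσ (3 : fieldF) →ₗ[ℚ] CubicCyclicAlgebra σ hσ (3 : fieldF),
        IsPositiveAntiInvolution φ ∧ IsOfSecondKind φ := by
  have hFE := fieldF_le_fieldE hlam hz hz_ne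
  have hlE : (lam : ℂ) ∈ fieldE lam z := IntermediateField.subset_adjoin _ _ (by simp)
  have hzE : z ∈ fieldE lam z := IntermediateField.subset_adjoin _ _ (by simp)
  obtain ⟨l, hl⟩ : ∃ l : IntermediateField.extendScalars hFE, (l : ℂ) = lam := ⟨⟨_, hlE⟩, rfl⟩
  obtain ⟨m, hm⟩ : ∃ m : IntermediateField.extendScalars hFE, (m : ℂ) = z := ⟨⟨_, hzE⟩, rfl⟩
  obtain ⟨n, hn⟩ : ∃ n : IntermediateField.extendScalars hFE, (n : ℂ) = (starRingEnd ℂ) z :=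
    ⟨⟨_, conj_mem_fieldE hlam hz hz_ne hzE⟩, rfl⟩
  obtain ⟨σ, hσl, hσm, hσn⟩ := exists_cyclic_automorphism hlam hz hz_ne hFE hl hm hn
  have hroot : (lam : ℂ) ^ 3 - (lam : ℂ) ^ 2 + 1 = 0 := by
    exact_mod_cast congrArg Complex.ofReal hlam
  have hq := quadratic_of_root hlam hz hz_ne
  have hspan : ∀ e : IntermediateField.extendScalars hFE, ∃ a b c : fieldF,
      e = algebraMap fieldF _ a + algebraMap fieldF _ b * l + algebraMap fieldF _ c * l ^ 2 := by
    rintro ⟨e, he⟩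
    rw [extendScalars_eq_adjoin hlam hz hz_ne hFE] at he
    obtain ⟨a, b, c, h⟩ := IntermediateField.exists_quadratic_of_mem_adjoin_simple
      monic_X_cube_sub_X_sq_add_one natDegree_X_cube_sub_X_sq_add_one.le
      (by simpa using hroot) he
    refine ⟨a, b, c, Subtype.ext ?_⟩
    push_cast
    rw [hl]
    exact h
  have hσ : σ ^ 3 = 1 := by
    refine AlgEquiv.ext fun e => ?_
    obtain ⟨a, b, c, rfl⟩ := hspan e
    simp [pow_succ, hσl, hσm, hσn]
  have hgen : IsCubicGenerator σ l := by
    refine ⟨hσ, ?_, ?_, ?_, hspan⟩ <;> rw [hσl, hσm] <;> apply Subtype.ext <;> push_cast <;>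
      rw [hl, hm, hn, conj_root hlam hz hz_ne]
    · ring
    · linear_combination -hq
    · linear_combination hroot - lam * hq
  let τ : IntermediateField.extendScalars hFE ≃ₐ[ℚ] IntermediateField.extendScalars hFE :=
    { toFun := fun e => ⟨(starRingEnd ℂ) e, conj_mem_fieldE hlam hz hz_ne e.2⟩
      invFun := fun e => ⟨(starRingEnd ℂ) e, conj_mem_fieldE hlam hz hz_ne e.2⟩
      left_inv := fun e => Subtype.ext (Complex.conj_conj _)
      right_inv := fun e => Subtype.ext (Complex.conj_conj _)
      map_mul' := fun x y => Subtype.ext (map_mul (starRingEnd ℂ) _ _)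
      map_add' := fun x y => Subtype.ext (map_add (starRingEnd ℂ) _ _)
      commutes' := fun q => Subtype.ext (map_ratCast (starRingEnd ℂ) q) }
  have hτ : ∀ e, ((τ e : IntermediateField.extendScalars hFE) : ℂ) = (starRingEnd ℂ) (e : ℂ) :=
    fun e => rfl
  have hτl : τ l = l := Subtype.ext (by rw [hτ, hl, Complex.conj_ofReal])
  have hτm : τ m = n := Subtype.ext (by rw [hτ, hm, hn])
  have hτn : τ n = m := Subtype.ext (by rw [hτ, hn, hm, Complex.conj_conj])
  let δ : fieldF := ⟨_, discriminant_root_mem hlam hz hz_ne⟩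
  have hδ : algebraMap fieldF (IntermediateField.extendScalars hFE) δ =
      (l - m) * (m - n) * (n - l) := by
    apply Subtype.ext
    push_cast
    rw [hl, hm, hn]
    rfl
  have hτδ : τ (algebraMap fieldF _ δ) = -algebraMap fieldF _ δ := by
    rw [hδ]
    simp only [map_mul, map_sub, hτl, hτm, hτn]
    ring
  have hFspan : ∀ a : fieldF, ∃ p q : ℚ, a = algebraMap ℚ fieldF p + algebraMap ℚ fieldF q * δ := by
    rintro ⟨a, ha⟩
    obtain ⟨p, q, h⟩ := fieldF_span_discriminant hlam hz hz_ne ha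
    exact ⟨p, q, Subtype.ext h⟩
  have hdihedral : IsDihedralConjugation
      (algebraMap (IntermediateField.extendScalars hFE) ℂ) τ σ δ := by
    refine ⟨hτ, fun e => ?_, hτδ, fun h0 => ?_, hFspan⟩
    -- The relation $\tau\sigma=\sigma^2\tau$ is checked on $F$, which `τ` preserves and `σ` fixes,
    -- and on `l`, which both sides send to `n`.
    · have hQ : ∀ q : ℚ, τ (algebraMap fieldF _ (algebraMap ℚ fieldF q)) =
          algebraMap fieldF _ (algebraMap ℚ fieldF q) := τ.commutes
      have hF : ∀ a : fieldF, τ (σ (algebraMap fieldF _ a)) =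
          σ (σ (τ (algebraMap fieldF _ a))) := by
        intro a
        obtain ⟨p, q, rfl⟩ := hFspan a
        simp only [map_add, map_mul, AlgEquiv.commutes, hτδ, map_neg, hQ]
      obtain ⟨a, b, c, rfl⟩ := hspan e
      simp only [map_add, map_mul, map_pow, hF, hσl, hσm, hτl, hτm]
    · have h1 := discriminant_root_sq hlam hz hz_ne
      rw [show _ * _ * _ = (0 : ℂ) from congrArg Subtype.val h0] at h1
      norm_num at h1
  obtain ⟨ι⟩ := fieldF_nonempty_ringHom_padic
  have hdiv : ∀ x : CubicCyclicAlgebra σ hσ (3 : fieldF), x ≠ 0 → IsUnit x :=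
    fun x hx => hgen.isUnit_of_ne_zero ι hx
  have hrank := hgen.finrank_eq_three ι
  have hfin : FiniteDimensional fieldF (IntermediateField.extendScalars hFE) :=
    FiniteDimensional.of_finrank_pos (by rw [hrank]; norm_num)
  have hfinQ : FiniteDimensional ℚ (IntermediateField.extendScalars hFE) :=
    FiniteDimensional.trans ℚ fieldF _
  refine ⟨hFE, σ, hσ, ⟨l, m, n, hl, hm, hn, hσl, hσm, hσn⟩, hdiv, ?_, ?_, ?_⟩
  · refine CubicCyclicAlgebra.isCentral_of_fixed l (fun h => hz_ne ?_) (fun h => hz_ne ?_)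
      hgen.exists_of_fixed
    · exact hm.symm.trans ((congrArg Subtype.val (hσl.symm.trans h)).trans hl)
    · rw [hσl, hσm] at h
      have h1 : (starRingEnd ℂ) z = lam := hn.symm.trans ((congrArg Subtype.val h).trans hl)
      rw [← Complex.conj_conj z, h1, Complex.conj_ofReal]
  · rw [CubicCyclicAlgebra.finrank_eq, hrank]
  · obtain ⟨b1, b2⟩ := real_root_bounds hlam
    -- $p=(1-\lambda)^2$ is large at the real root, at least $1.74^2>3$, while its conjugate
    -- $(1-z)^2$ has absolute value $\lambda^2<3/5$.
    refine hdihedral.exists_isPositiveAntiInvolution hgen.exists_trace hdiv ((1 - l) ^ 2)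
      (by simp [hτl]) ?_ ?_
    · have h1 : algebraMap (IntermediateField.extendScalars hFE) ℂ ((1 - l) ^ 2) =
          (((1 - lam) ^ 2 : ℝ) : ℂ) := by
        rw [IntermediateField.algebraMap_apply]
        push_cast
        rw [hl]
      rw [h1, Complex.ofReal_re]
      nlinarith
    · have h1 : algebraMap (IntermediateField.extendScalars hFE) ℂ (σ ((1 - l) ^ 2)) =
          (1 - z) ^ 2 := by
        rw [map_pow, map_sub, map_one, hσl, IntermediateField.algebraMap_apply]
        push_cast
        rw [hm]
      rw [h1]
      exact norm_one_sub_root_sq hlam hz hz_ne
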